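/- Let $q$ be a prime power, let $r\mid q-1$, and let $\lambda\in\mathbb F_q^*$ have multiplicative order $r$. A linear code $C\subseteq\mathbb F_q^n$ is $\lambda$-constacyclic if $(\lambda c_{n-1},c_0,\dots,c_{n-2})\in C$ for every $(c_0,\dots,c_{n-1})\in C$; an $[n,k,\ge D]$ code is a $k$-dimensional subspace of $\mathbb F_q^n$ in which any two distinct elements have Hamming distance at least $D$ (no condition if $k=0$). Let $n$ be a prime with $n\nmid q$ and $n\nmid q-1$, and let $m=\mathrm{ord}_n(q)$ be the multiplicative order of $q$ modulo $n$. Put $s=(q^m-1)/(nr)$ and $A=\left\lceil\frac{q\lceil (n-1)/(2m)\rceil}{q-1}\right\rceil$. Let $S_m$ be the set of integer triples $(i,j,t)$ such that $$\tfrac{m+1}{2}\le i\le\lfloor m-\log_q(s+1)\rfloor,\quad 1\le j\le q-1,\quad 0\le t<\frac{q^i-j(q^{m-i}-1)-1}{q^{m-i+1}-q},$$ $$q^i+qt+j\equiv 1\pmod r,\qquad q^i+qt+j\le 1+(A-2)r,$$ and let $\Lambda_m=\left\lceil\frac{q|S_m|}{q-1}\right\rceil-1$. Then there is a $\lambda$-constacyclic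 $$\left[n,\ n-1-m\left\lceil\tfrac{n-1}{2m}\right\rceil,\ \ge A+\Lambda_m\right]$$ code over $\mathbb F_q$. If moreover $2m(q-1)\ge qr$, there is also a $\lambda$-constacyclic $$\left[n,\ n-m\left\lfloor\tfrac{n-1}{2m}\right\rfloor,\ \ge\left\lfloor\tfrac{q(n-1)}{2m(q-1)}\right\rfloor\right]$$ code over $\mathbb F_q$. For fixed $q$ and $\lambda$ both families are infinite: infinitely many primes $n$ satisfy $n\nmid q$ and $n\nmid q-1$, and infinitely many of these also satisfy $2m(q-1)\ge qr$. -/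

import Mathlib

noncomputable section

/-- The constacyclic shift `(c₀, c₁, …, cₙ₋₁) ↦ (a * cₙ₋₁, c₀, …, cₙ₋₂)` on `Fⁿ`. -/
def constacyclicShift {F : Type*} [Field F] {n : ℕ} (a : F) (c : Fin n → F) : Fin n → F :=
  fun i =>
    if (i : ℕ) = 0 then a * c ⟨n - 1, by have := i.isLt; omega⟩
    else c ⟨(i : ℕ) - 1, by have := i.isLt; omega⟩

/-- A linear code `C ⊆ Fⁿ` is `a`-constacyclic if it is closed under the `a`-constacyclic shift. -/
def IsConstacyclic {F : Type*} [Field F] {n : ℕ} (a : F) (C : Submodule F (Fin n → F)) : Prop :=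
  ∀ c ∈ C, constacyclicShift a c ∈ C

/-- The minimum distance of the code `C` is at least `D`: any two distinct codewords have Hamming
distance at least `D` (no condition when `C` is the zero code). -/
def MinDistGE {F : Type*} [Field F] [DecidableEq F] {n : ℕ} (C : Submodule F (Fin n → F))
    (D : ℤ) : Prop :=
  ∀ x ∈ C, ∀ y ∈ C, x ≠ y → D ≤ (hammingDist x y : ℤ)

/-- There is an `a`-constacyclic `[n, k, ≥ D]` code over `F`. -/
def ExistsConstacyclicCode {F : Type*} [Field F] [DecidableEq F] (a : F) (n : ℕ) (k D : ℤ) :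
    Prop :=
  ∃ C : Submodule F (Fin n → F),
    IsConstacyclic a C ∧ (Module.finrank F C : ℤ) = k ∧ MinDistGE C D

/-- The multiplicative order of `q` modulo `n`. -/
def ordMod (n q : ℕ) : ℕ := orderOf (q : ZMod n)

/-- `⌈(n - 1) / (2 m)⌉`, where `(n - 1) / m` is the number of cyclotomic cosets of size `m`. -/
def halfCeil (n m : ℕ) : ℤ := ⌈((n : ℝ) - 1) / (2 * m)⌉

/-- `⌊(n - 1) / (2 m)⌋`. -/
def halfFloor (n m : ℕ) : ℤ := ⌊((n : ℝ) - 1) / (2 * m)⌋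

/-- `⌈q ⌈(n - 1) / (2 m)⌉ / (q - 1)⌉`. -/
def mainBound (q n m : ℕ) : ℤ := ⌈(q : ℝ) * (halfCeil n m : ℝ) / ((q : ℝ) - 1)⌉

/-- The set `S_m` of triples `(i, j, t)`, with `s = (q ^ m - 1) / (n r)`. The second condition
forces `i < m` (as `s > 0`), so the subtractions in the exponents are not truncated. -/
def setS (q n r m : ℕ) : Set (ℕ × ℕ × ℕ) :=
  {x | ∃ i j t : ℕ, x = (i, j, t) ∧
    ((m : ℝ) + 1) / 2 ≤ (i : ℝ) ∧
    (i : ℤ) ≤ ⌊(m : ℝ) - Real.logb (q : ℝ) (((q : ℝ) ^ m - 1) / ((n : ℝ) * (r : ℝ)) + 1)⌋ ∧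
    1 ≤ j ∧ j ≤ q - 1 ∧
    (t : ℝ) < ((q : ℝ) ^ i - (j : ℝ) * ((q : ℝ) ^ (m - i) - 1) - 1) /
      ((q : ℝ) ^ (m - i + 1) - (q : ℝ)) ∧
    q ^ i + q * t + j ≡ 1 [MOD r] ∧
    ((q ^ i + q * t + j : ℕ) : ℤ) ≤ 1 + (mainBound q n m - 2) * (r : ℤ)}

/-- `Λ_m = ⌈q |S_m| / (q - 1)⌉ - 1`. -/
def bigLambda (q n r m : ℕ) : ℤ :=
  ⌈(q : ℝ) * ((setS q n r m).ncard : ℝ) / ((q : ℝ) - 1)⌉ - 1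

end

/-! Since `n` is coprime to `q - 1`, `λ = e ^ n` with `e` in `F`, and there is `β` in the algebraic
closure with `β ^ n = λ` and `β ^ r` a primitive `n`-th root of unity. The roots of `X ^ n - λ` are
the powers `β ^ (1 + r k)`. If the multiples of a factor `g` form the code and `g` kills these
powers for all `k < B`, a Vandermonde argument (`lt_hammingNorm_of_forall_sum_eq_zero`) makes the
distance exceed `B`. As `n` is prime, `X ^ n - λ` is `X - e` times `(n - 1) / m` irreducible factors
of degree `m` (`exists_factors`), so the dimension depends only on how many conjugacy classes `g`
uses.

The point is to count the classes met by the first `B` exponents. An exponent divisible by `q` is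
conjugate to its quotient by `q`, which saves `⌊B / q⌋` classes. For a triple `(i, j, t)` and `w = q
t + j`, multiplying `q ^ i + w` by `q ^ (m - i)` gives `1 + w q ^ (m - i)` modulo `q ^ m - 1`, which
is smaller by the bound on `t`; this saves `|S_m|` more (`exists_smaller_conjugate`). By descent
(`exists_conjugate`), at most `B - ⌊B / q⌋ - |S_m|` classes occur (`card_filter_add_le`), and `B` is
chosen so that about half of the available classes suffice.

The first family always includes the factor `X - e`. The second uses no triples and omits that
factor: `2 m (q - 1) ≥ q r` keeps every exponent below `n`, whereas `β ^ u` in `F` forces `n ∣ u`.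
-/

open Polynomial

/-! ### The BCH bound and codes of multiples of a polynomial -/

/-- The BCH bound for constacyclic codes. -/
theorem lt_hammingNorm_of_forall_sum_eq_zero {F K : Type*} [Field F] [DecidableEq F] [Field K]
    [Algebra F K] {n r B : ℕ} {β : K} (hβ : β ≠ 0) (hr : IsPrimitiveRoot (β ^ r) n)
    {c : Fin n → F} (hc : c ≠ 0)
    (h : ∀ k < B, ∑ i : Fin n, algebraMap F K (c i) * (β ^ (1 + r * k)) ^ (i : ℕ) = 0) :
    B < hammingNorm c := by
  by_contra! hB
  set s : Finset (Fin n) := Finset.univ.filter fun i => c i ≠ 0 with hs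
  have hsB : s.card ≤ B := hB
  let e : Fin s.card ≃ s := s.equivFin.symm
  have hf : Function.Injective fun j : Fin s.card => (β ^ r) ^ ((e j : Fin n) : ℕ) := by
    intro a b hab
    have := hr.pow_inj (e a).1.isLt (e b).1.isLt hab
    exact e.injective (Subtype.ext (Fin.ext this))
  -- Vandermonde on the support of `c`: the unknowns are `c_i β ^ i`, the nodes `(β ^ r) ^ i` are
  -- distinct, and as many equations are used as the support has elements.
  have hv := Matrix.eq_zero_of_forall_pow_sum_mul_pow_eq_zero
    (v := fun j => algebraMap F K (c (e j)) * β ^ ((e j : Fin n) : ℕ)) hf (by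
      rintro ⟨k, hk⟩
      dsimp only
      rw [Equiv.sum_comp e (fun i : s => algebraMap F K (c i) * β ^ ((i : Fin n) : ℕ) *
        ((β ^ r) ^ ((i : Fin n) : ℕ)) ^ k), Finset.sum_coe_sort s
        (fun i => algebraMap F K (c i) * β ^ (i : ℕ) * ((β ^ r) ^ (i : ℕ)) ^ k),
        ← h k (hk.trans_le hsB), hs, Finset.sum_filter]
      refine Finset.sum_congr rfl fun i _ => ?_
      split_ifs with hi
      · rw [mul_assoc]
        congr 1
        simp only [← pow_mul, ← pow_add]
        congr 1
        ring
      · simp [not_not.mp hi])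
  apply hc
  funext i
  by_contra hi
  have his : i ∈ s := by simpa [hs] using hi
  have := congrFun hv (e.symm ⟨i, his⟩)
  simp only [Equiv.apply_symm_apply, Pi.zero_apply, mul_eq_zero, map_eq_zero, pow_eq_zero_iff',
    hβ, false_and, or_false] at this
  exact hi this

/-- The polynomial with coefficient vector `c`. -/
noncomputable def vecPoly {F : Type*} [Field F] (n : ℕ) : (Fin n → F) →ₗ[F] F[X] :=
  (degreeLT F n).subtype ∘ₗ (degreeLTEquiv F n).symm.toLinearMap

theorem vecPoly_apply {F : Type*} [Field F] {n : ℕ} (c : Fin n → F) :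
    vecPoly n c = ∑ i : Fin n, monomial i (c i) := rfl

/-- The code of length `n` of all multiples of `g`. -/
noncomputable def polyCode {F : Type*} [Field F] (n : ℕ) (g : F[X]) : Submodule F (Fin n → F) :=
  ((Ideal.span {g}).restrictScalars F).comap (vecPoly n)

theorem mem_polyCode {F : Type*} [Field F] {n : ℕ} {g : F[X]} {c : Fin n → F} :
    c ∈ polyCode n g ↔ g ∣ vecPoly n c := by
  simp [polyCode, Ideal.mem_span_singleton]

theorem finrank_polyCode {F : Type*} [Field F] {n : ℕ} {g : F[X]} (hg : g.Monic)
    (hn : g.natDegree ≤ n) : Module.finrank F (polyCode n g) + g.natDegree = n := by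
  let φ : (Fin n → F) →ₗ[F] (F[X] ⧸ Ideal.span {g}) :=
    (Ideal.Quotient.mkₐ F (Ideal.span {g})).toLinearMap ∘ₗ vecPoly n
  have hker : polyCode n g = LinearMap.ker φ := by
    ext c
    simp [φ, mem_polyCode, Ideal.Quotient.eq_zero_iff_mem, Ideal.mem_span_singleton]
  have hsurj : Function.Surjective φ := by
    intro y
    obtain ⟨p, rfl⟩ := Ideal.Quotient.mk_surjective y
    have hp : p %ₘ g ∈ degreeLT F n := by
      rw [mem_degreeLT]
      refine (degree_modByMonic_lt p hg).trans_le ?_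
      rw [degree_eq_natDegree hg.ne_zero]
      exact_mod_cast hn
    refine ⟨degreeLTEquiv F n ⟨_, hp⟩, ?_⟩
    simp only [φ, vecPoly, LinearMap.comp_apply, LinearEquiv.coe_coe,
      LinearEquiv.symm_apply_apply, Submodule.subtype_apply, AlgHom.toLinearMap_apply,
      Ideal.Quotient.mkₐ_eq_mk]
    rw [Ideal.Quotient.eq, Ideal.mem_span_singleton]
    exact ⟨-(p /ₘ g), by linear_combination modByMonic_add_div p g⟩
  have h := LinearMap.finrank_range_add_finrank_ker φ
  rw [LinearMap.range_eq_top.mpr hsurj, finrank_top, finrank_quotient_span_eq_natDegree,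
    Module.finrank_fin_fun, ← hker] at h
  omega

theorem vecPoly_constacyclicShift {F : Type*} [Field F] {n : ℕ} (a : F) (c : Fin (n + 1) → F) :
    vecPoly (n + 1) (constacyclicShift a c) =
      X * vecPoly (n + 1) c - C (c (Fin.last n)) * (X ^ (n + 1) - C a) := by
  rw [vecPoly_apply, vecPoly_apply, Fin.sum_univ_succ, Fin.sum_univ_castSucc]
  have h : ∀ i : Fin n, constacyclicShift a c i.succ = c i.castSucc := by
    intro i
    simp only [constacyclicShift, Fin.val_succ, Nat.succ_ne_zero, if_false]
    rfl
  have h0 : constacyclicShift a c 0 = a * c (Fin.last n) := by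
    simp only [constacyclicShift, Fin.val_zero, if_true]
    rfl
  simp only [h, h0, mul_add, Finset.mul_sum, Fin.val_succ, Fin.val_castSucc,
    Fin.val_zero, Fin.val_last, ← C_mul_X_pow_eq_monomial, map_mul, pow_succ]
  simp only [← mul_assoc, mul_comm X]
  ring

theorem isConstacyclic_polyCode {F : Type*} [Field F] {n : ℕ} {a : F} {g : F[X]}
    (hg : g ∣ X ^ n - C a) : IsConstacyclic a (polyCode n g) := by
  intro c hc
  rw [mem_polyCode] at hc ⊢
  cases n with
  | zero => simp [vecPoly_apply]
  | succ n =>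
    rw [vecPoly_constacyclicShift]
    exact dvd_sub (hc.mul_left _) (hg.mul_left _)

theorem sum_mul_pow_eq_zero_of_mem_polyCode {F K : Type*} [Field F] [Field K] [Algebra F K]
    {n : ℕ} {g : F[X]} {x : K} (hx : aeval x g = 0) {c : Fin n → F} (hc : c ∈ polyCode n g) :
    ∑ i : Fin n, algebraMap F K (c i) * x ^ (i : ℕ) = 0 := by
  have := zero_dvd_iff.mp (hx ▸ map_dvd (aeval x) (mem_polyCode.mp hc))
  simpa [vecPoly_apply, aeval_monomial] using this

/-- A set of monic irreducible factors of `X ^ n - a` containing the minimal polynomials of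
`B` consecutive powers gives a constacyclic code of minimum distance more than `B`. -/
theorem exists_code_of_factors {F K : Type*} [Field F] [DecidableEq F] [Field K] [Algebra F K]
    {n r B : ℕ} (hn : 0 < n) {a : F} {β : K} (hβ : β ≠ 0) (hr : IsPrimitiveRoot (β ^ r) n)
    (Q : Finset F[X]) (hirr : ∀ f ∈ Q, Irreducible f) (hmon : ∀ f ∈ Q, f.Monic)
    (hdvd : ∀ f ∈ Q, f ∣ X ^ n - C a) (hB : ∀ k < B, minpoly F (β ^ (1 + r * k)) ∈ Q) :
    ∃ C : Submodule F (Fin n → F), IsConstacyclic a C ∧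
      Module.finrank F C + ∑ f ∈ Q, f.natDegree = n ∧ MinDistGE C (B + 1) := by
  have hg : (∏ f ∈ Q, f).Monic := monic_prod_of_monic _ _ hmon
  have hgd : ∏ f ∈ Q, f ∣ X ^ n - C a := by
    refine Finset.prod_dvd_of_coprime (fun f hf f' hf' hne => ?_) hdvd
    refine ((hirr f hf).coprime_iff_not_dvd).mpr fun h => hne ?_
    exact eq_of_monic_of_associated (hmon f hf) (hmon f' hf')
      ((hirr f hf).associated_of_dvd (hirr f' hf') h)
  have hdeg : (∏ f ∈ Q, f).natDegree = ∑ f ∈ Q, f.natDegree := natDegree_prod_of_monic _ _ hmon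
  refine ⟨polyCode n (∏ f ∈ Q, f), isConstacyclic_polyCode hgd, ?_, ?_⟩
  · rw [← hdeg]
    refine finrank_polyCode hg ?_
    simpa using natDegree_le_of_dvd hgd (X_pow_sub_C_ne_zero hn a)
  · intro x hx y hy hxy
    have hlt : B < hammingNorm (-x + y) := by
      refine lt_hammingNorm_of_forall_sum_eq_zero hβ hr (neg_add_eq_zero.not.mpr hxy) fun k hk => ?_
      refine sum_mul_pow_eq_zero_of_mem_polyCode ?_ (add_mem (neg_mem hx) hy)
      exact zero_dvd_iff.mp
        (minpoly.aeval F (β ^ (1 + r * k)) ▸ map_dvd (aeval (β ^ (1 + r * k)))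
          (Finset.dvd_prod_of_mem (fun f => f) (hB k hk)))
    rw [hammingDist_eq_hammingNorm]
    exact_mod_cast hlt

/-! ### Conjugate roots and the factorization of `X ^ n - λ` -/

theorem minpoly_pow_card {F K : Type*} [Field F] [Fintype F] [Field K] [Algebra F K] (x : K) :
    minpoly F (x ^ Fintype.card F) = minpoly F x :=
  minpoly.algHom_eq (FiniteField.frobeniusAlgHom F K) (RingHom.injective _) x

theorem minpoly_pow_card_pow {F K : Type*} [Field F] [Fintype F] [Field K] [Algebra F K] (x : K)
    (j : ℕ) : minpoly F (x ^ Fintype.card F ^ j) = minpoly F x := by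
  induction j with
  | zero => simp
  | succ j ih => rw [pow_succ, pow_mul, minpoly_pow_card, ih]

theorem natCast_ne_zero_of_coprime_card {F : Type*} [Field F] [Fintype F] {n : ℕ}
    (h : n.Coprime (Fintype.card F)) : (n : F) ≠ 0 := by
  intro h0
  have := h.cast (R := F)
  rw [h0, FiniteField.cast_card_eq_zero] at this
  exact not_isCoprime_zero_zero this

/-- Raising to the power `n` is bijective on the units of `F`, which gives `e`. Take `β = e η` with
`η` a primitive `n`-th root of unity: then `e ^ r = 1`, so `β ^ r = η ^ r`, and `r` is coprime to
`n`. -/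
theorem exists_primitive_pow {F : Type*} (K : Type*) [Field F] [Fintype F] [Field K] [IsAlgClosed K]
    [Algebra F K] {n : ℕ} (hn : n.Prime) (hnq : n.Coprime (Fintype.card F))
    (hnq' : ¬ n ∣ Fintype.card F - 1) (lam : Fˣ) :
    ∃ e : F, ∃ β : K, e ^ n = lam ∧ β ^ n = algebraMap F K lam ∧
      IsPrimitiveRoot (β ^ orderOf lam) n := by
  classical
  have hcop : n.Coprime (Fintype.card F - 1) := (hn.coprime_iff_not_dvd).mpr hnq'
  have hcard : Nat.card Fˣ = Fintype.card F - 1 := by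
    rw [Nat.card_eq_fintype_card, Fintype.card_units]
  have hcop' : (Nat.card Fˣ).Coprime n := hcard ▸ hcop.symm
  obtain ⟨e, he⟩ := (powCoprime hcop').surjective lam
  replace he : e ^ n = lam := he
  have her : e ^ orderOf lam = 1 := by
    apply (powCoprime hcop').injective
    change (e ^ orderOf lam) ^ n = 1 ^ n
    rw [← pow_mul, mul_comm, pow_mul, he, pow_orderOf_eq_one, one_pow]
  have hnK : NeZero (n : K) := by
    refine ⟨fun h => natCast_ne_zero_of_coprime_card hnq ?_⟩
    apply (algebraMap F K).injective
    simpa using h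
  obtain ⟨η, hη⟩ := HasEnoughRootsOfUnity.exists_primitiveRoot K n
  refine ⟨e, algebraMap F K e * η, by exact_mod_cast congrArg Units.val he, ?_, ?_⟩
  · rw [mul_pow, hη.pow_eq_one, mul_one, ← map_pow, ← he, Units.val_pow_eq_pow_val]
  · rw [mul_pow, ← map_pow, ← Units.val_pow_eq_pow_val, her, Units.val_one, map_one, one_mul]
    refine hη.pow_of_coprime _ (Nat.Coprime.symm (hcop.coprime_dvd_right ?_))
    exact hcard ▸ orderOf_dvd_natCard lam

/-- A nonzero element of `F` has `(q - 1)`-th power one, hence `(β ^ r) ^ (u (q - 1)) = 1` and `n`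
divides `u (q - 1)`. -/
theorem dvd_of_pow_eq_algebraMap {F K : Type*} [Field F] [Fintype F] [Field K] [Algebra F K]
    {n r u : ℕ} (hn : n.Prime) (hnq' : ¬ n ∣ Fintype.card F - 1) {β : K} (hβ : β ≠ 0)
    (hr : IsPrimitiveRoot (β ^ r) n) {e : F} (h : β ^ u = algebraMap F K e) : n ∣ u := by
  have he : e ≠ 0 := by
    rintro rfl
    exact pow_ne_zero u hβ (by simpa using h)
  have h1 : (β ^ r) ^ (u * (Fintype.card F - 1)) = 1 := by
    rw [← pow_mul, mul_comm, mul_assoc, pow_mul, h, ← map_pow, mul_comm, mul_comm,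
      pow_mul, FiniteField.pow_card_sub_one_eq_one e he, one_pow, map_one]
  exact (hn.dvd_mul.mp ((hr.pow_eq_one_iff_dvd _).mp h1)).resolve_right hnq'

theorem natDegree_minpoly_of_isPrimitiveRoot {F K : Type*} [Field F] [Fintype F] [Field K]
    [Algebra F K] {n : ℕ} (hn : 0 < n) (hnq : n.Coprime (Fintype.card F)) {ω : K}
    (hω : IsPrimitiveRoot ω n) : (minpoly F ω).natDegree = ordMod n (Fintype.card F) := by
  obtain ⟨p, _, f, hp, hf⟩ := FiniteField.card' F
  have : Fact p.Prime := ⟨hp⟩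
  have hint : IsIntegral F ω := ⟨X ^ n - 1, monic_X_pow_sub_C 1 hn.ne', by
    simp [hω.pow_eq_one]⟩
  have hpn : p.Coprime n := by
    rw [hf] at hnq
    exact (Nat.Coprime.coprime_dvd_right (dvd_pow_self p f.ne_zero) hnq).symm
  have hdvd : minpoly F ω ∣ cyclotomic n F := by
    apply minpoly.dvd
    have : NeZero (n : K) := by
      refine ⟨fun h => natCast_ne_zero_of_coprime_card hnq ?_⟩
      apply (algebraMap F K).injective
      simpa using h
    rw [aeval_def, ← eval_map, map_cyclotomic]
    exact (isRoot_cyclotomic_iff).mpr hω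
  rw [natDegree_of_dvd_cyclotomic_of_irreducible hf hpn hdvd (minpoly.irreducible hint),
    ordMod, ← orderOf_units, ZMod.coe_unitOfCoprime, hf]

/-- The quotient `x / e` is an `n`-th root of unity other than one, hence primitive as `n` is prime,
and it generates the same extension of `F` as `x`. -/
theorem natDegree_minpoly_of_pow_eq {F K : Type*} [Field F] [Fintype F] [Field K] [Algebra F K]
    {n : ℕ} (hn : n.Prime) (hnq : n.Coprime (Fintype.card F)) {a e : F} (ha : a ≠ 0)
    (he : e ^ n = a) {x : K} (hx : x ^ n = algebraMap F K a) (hxe : x ≠ algebraMap F K e) :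
    (minpoly F x).natDegree = ordMod n (Fintype.card F) := by
  have he0 : e ≠ 0 := by
    rintro rfl
    exact ha (by rw [← he, zero_pow hn.ne_zero])
  have he0' : algebraMap F K e ≠ 0 := by simpa using he0
  set ω : K := x / algebraMap F K e with hωdef
  have hω : IsPrimitiveRoot ω n := by
    have : Fact n.Prime := ⟨hn⟩
    have hω1 : ω ≠ 1 := fun h => hxe ((div_eq_one_iff_eq he0').mp h)
    have h1 : ω ^ n = 1 := by
      rw [div_pow, hx, ← map_pow, he, div_self]
      simpa using ha
    exact orderOf_eq_prime h1 hω1 ▸ IsPrimitiveRoot.orderOf ω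
  rw [← natDegree_minpoly_of_isPrimitiveRoot hn.pos hnq hω]
  have hxint : IsIntegral F x := by
    refine IsIntegral.of_pow hn.pos ?_
    rw [hx]
    exact isIntegral_algebraMap
  have hωint : IsIntegral F ω := by
    refine IsIntegral.of_pow hn.pos ?_
    rw [hω.pow_eq_one]
    exact isIntegral_one
  rw [← IntermediateField.adjoin.finrank hxint, ← IntermediateField.adjoin.finrank hωint]
  have : IntermediateField.adjoin F {x} = IntermediateField.adjoin F {ω} := by
    apply le_antisymm <;> rw [IntermediateField.adjoin_simple_le_iff]
    · have : x = ω * algebraMap F K e := by rw [hωdef, div_mul_cancel₀ _ he0']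
      rw [this]
      exact mul_mem (IntermediateField.mem_adjoin_simple_self F ω)
        (IntermediateField.algebraMap_mem _ e)
    · exact div_mem (IntermediateField.mem_adjoin_simple_self F x)
        (IntermediateField.algebraMap_mem _ e)
  rw [this]

/-- Over a finite field with `q` elements, if `n` is a prime not dividing `q`, then `X ^ n - e ^ n`
is the product of `X - e` and of irreducible factors of degree the order of `q` modulo `n`. -/
theorem exists_factors {F : Type*} [Field F] [Fintype F] {n : ℕ} (hn : n.Prime)
    (hnq : n.Coprime (Fintype.card F)) {a e : F} (ha : a ≠ 0) (he : e ^ n = a) :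
    ∃ P : Finset F[X], (∀ f, f ∈ P ↔ f ≠ X - C e ∧ Irreducible f ∧ f.Monic ∧ f ∣ X ^ n - C a) ∧
      (∀ f ∈ P, f.natDegree = ordMod n (Fintype.card F)) ∧
      P.card * ordMod n (Fintype.card F) + 1 = n := by
  classical
  have hmonic : (X ^ n - C a : F[X]).Monic := monic_X_pow_sub_C a hn.ne_zero
  have h0 := hmonic.ne_zero
  have hsq : Squarefree (X ^ n - C a : F[X]) :=
    (separable_X_pow_sub_C a (natCast_ne_zero_of_coprime_card hnq) ha).squarefree
  set P₀ : Finset F[X] := (UniqueFactorizationMonoid.normalizedFactors (X ^ n - C a)).toFinset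
    with hP₀
  have hmem : ∀ f, f ∈ P₀ ↔ Irreducible f ∧ f.Monic ∧ f ∣ X ^ n - C a := by
    intro f
    rw [hP₀, Multiset.mem_toFinset, Polynomial.mem_normalizedFactors_iff h0]
  have hprod : ∏ f ∈ P₀, f = X ^ n - C a := by
    have h1 := UniqueFactorizationMonoid.prod_normalizedFactors_eq h0
    rw [hmonic.normalize_eq_self] at h1
    have hnd := (UniqueFactorizationMonoid.squarefree_iff_nodup_normalizedFactors h0).mp hsq
    rw [Finset.prod, hP₀, Multiset.toFinset_val, Multiset.dedup_eq_self.mpr hnd, Multiset.map_id',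
      h1]
  have hlin : X - C e ∈ P₀ := by
    rw [hmem]
    refine ⟨irreducible_X_sub_C e, monic_X_sub_C e, ?_⟩
    rw [dvd_iff_isRoot]
    simp [he]
  have hdeg : ∀ f ∈ P₀.erase (X - C e), f.natDegree = ordMod n (Fintype.card F) := by
    intro f hf
    obtain ⟨hne, hf⟩ := Finset.mem_erase.mp hf
    obtain ⟨hirr, hmon, hdvd⟩ := (hmem f).mp hf
    obtain ⟨x, hx⟩ := IsAlgClosed.exists_aeval_eq_zero (AlgebraicClosure F) f
      (degree_pos_of_irreducible hirr).ne'
    have hfx : f = minpoly F x := minpoly.eq_of_irreducible_of_monic hirr hx hmon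
    have hxn : x ^ n = algebraMap F (AlgebraicClosure F) a := by
      have := zero_dvd_iff.mp (hx ▸ map_dvd (aeval x) hdvd)
      simpa [sub_eq_zero] using this
    rw [hfx]
    refine natDegree_minpoly_of_pow_eq hn hnq ha he hxn ?_
    rintro rfl
    exact hne (by rw [hfx, minpoly.eq_X_sub_C])
  refine ⟨P₀.erase (X - C e), fun f => by rw [Finset.mem_erase, hmem], hdeg, ?_⟩
  have h2 : ∑ f ∈ P₀, f.natDegree = n := by
    rw [← natDegree_prod_of_monic _ _ fun f hf => ((hmem f).mp hf).2.1, hprod, natDegree_X_pow_sub_C]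
  rw [← Finset.sum_erase_add _ _ hlin, Finset.sum_congr rfl hdeg, Finset.sum_const,
    natDegree_X_sub_C, smul_eq_mul] at h2
  exact h2

/-! ### Counting exponents up to conjugacy -/

theorem exists_one_add_mul {r v : ℕ} (hv : 0 < v) (h : v ≡ 1 [MOD r]) : ∃ k, v = 1 + r * k := by
  obtain ⟨k, hk⟩ := (Nat.modEq_iff_dvd' hv).mp h.symm
  exact ⟨k, by omega⟩

theorem modEq_one_of_dvd_sub_one {q r : ℕ} (hq : 0 < q) (h : r ∣ q - 1) : q ≡ 1 [MOD r] :=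
  ((Nat.modEq_iff_dvd' hq).mpr h).symm

/-- Every exponent congruent to `1` modulo `r` is conjugate to one that is not divisible by `q` and
avoids a given set of exponents having a smaller conjugate. -/
theorem exists_conjugate {F K : Type*} [Field F] [Fintype F] [Field K] [Algebra F K] {r : ℕ}
    (hr : r ∣ Fintype.card F - 1) {β : K} {U : Finset ℕ}
    (hU : ∀ u ∈ U, ∃ k, 1 + r * k < u ∧ minpoly F (β ^ u) = minpoly F (β ^ (1 + r * k))) (k : ℕ) :
    ∃ k' ≤ k, ¬ Fintype.card F ∣ 1 + r * k' ∧ 1 + r * k' ∉ U ∧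
      minpoly F (β ^ (1 + r * k)) = minpoly F (β ^ (1 + r * k')) := by
  induction k using Nat.strong_induction_on with
  | _ k ih =>
    have hq := Fintype.one_lt_card (α := F)
    have step : (∃ l, 1 + r * l < 1 + r * k ∧
        minpoly F (β ^ (1 + r * k)) = minpoly F (β ^ (1 + r * l))) →
        ∃ k' ≤ k, ¬ Fintype.card F ∣ 1 + r * k' ∧ 1 + r * k' ∉ U ∧
          minpoly F (β ^ (1 + r * k)) = minpoly F (β ^ (1 + r * k')) := by
      rintro ⟨l, hl, hmin⟩
      have hlk : l < k := lt_of_mul_lt_mul_left (by omega) (Nat.zero_le r)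
      obtain ⟨k', hk', h1, h2, h3⟩ := ih l hlk
      exact ⟨k', hk'.trans hlk.le, h1, h2, hmin.trans h3⟩
    by_cases hdvd : Fintype.card F ∣ 1 + r * k
    · obtain ⟨v, hv⟩ := hdvd
      have hv0 : 0 < v := Nat.pos_of_ne_zero fun h => by simp [h] at hv
      -- Dividing by `q` stays in the progression `1 + r k` because `q ≡ 1` modulo `r`.
      have hmod : v ≡ 1 [MOD r] := by
        have h1 : Fintype.card F * v ≡ 1 * v [MOD r] :=
          (modEq_one_of_dvd_sub_one (by omega) hr).mul_right v
        rw [← hv, one_mul] at h1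
        refine h1.symm.trans ?_
        simp [Nat.ModEq]
      obtain ⟨l, rfl⟩ := exists_one_add_mul hv0 hmod
      refine step ⟨l, ?_, ?_⟩
      · rw [hv]
        nlinarith
      · rw [hv, mul_comm, pow_mul, minpoly_pow_card]
    · by_cases hkU : 1 + r * k ∈ U
      · exact step (hU _ hkU)
      · exact ⟨k, le_rfl, hdvd, hkU, rfl⟩

theorem card_filter_add_le {q r B : ℕ} (hq : 1 < q) (hr : r ∣ q - 1) {U : Finset ℕ}
    (hU : ∀ u ∈ U, ¬ q ∣ u ∧ ∃ k < B, u = 1 + r * k) :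
    ((Finset.range B).filter fun k => ¬ q ∣ 1 + r * k ∧ 1 + r * k ∉ U).card + B / q + U.card
      ≤ B := by
  obtain ⟨b, hb⟩ := hr
  have hr0 : 0 < r := Nat.pos_of_ne_zero fun h => by
    simp [h] at hb
    omega
  have hbq : b ≤ q - 1 := hb ▸ Nat.le_mul_of_pos_left b hr0
  set L := (Finset.range B).filter fun k => ¬ q ∣ 1 + r * k ∧ 1 + r * k ∉ U with hL
  set M := (Finset.range B).filter fun k => q ∣ 1 + r * k with hM
  set V := (Finset.range B).filter fun k => ¬ q ∣ 1 + r * k ∧ 1 + r * k ∈ U with hV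
  have hMcard : B / q ≤ M.card := by
    rw [← Finset.card_range (B / q)]
    -- With `q = 1 + r b`, the index `b + q l` gives the exponent `q (1 + r l)`; it is less than `B`
    -- since `b ≤ q - 1`.
    refine Finset.card_le_card_of_injOn (fun l => b + q * l) ?_ ?_
    · intro l hl
      have hl' : l < B / q := by simpa using hl
      have h1 : q * (l + 1) ≤ B := (Nat.mul_le_mul_left q hl').trans (Nat.mul_div_le B q)
      simp only [hM, Finset.coe_filter, Finset.mem_range, Set.mem_ofPred_eq]
      refine ⟨by rw [mul_add] at h1; omega, 1 + r * l, ?_⟩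
      have h2 : 1 + r * b = q := by omega
      calc 1 + r * (b + q * l) = (1 + r * b) + q * (r * l) := by ring
        _ = q * (1 + r * l) := by rw [h2]; ring
    · intro x _ y _ hxy
      simp only [Nat.add_left_cancel_iff] at hxy
      exact Nat.eq_of_mul_eq_mul_left (by omega) hxy
  have hUcard : U.card ≤ V.card := by
    have hsub : U ⊆ V.image fun k => 1 + r * k := by
      intro u hu
      obtain ⟨h1, k, hk, rfl⟩ := hU u hu
      exact Finset.mem_image.mpr ⟨k, by simp [hV, hk, h1, hu], rfl⟩
    exact (Finset.card_le_card hsub).trans Finset.card_image_le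
  have h1 : M.card + ((Finset.range B).filter fun k => ¬ q ∣ 1 + r * k).card = B := by
    rw [hM, Finset.card_filter_add_card_filter_not, Finset.card_range]
  have h2 : V.card + L.card = ((Finset.range B).filter fun k => ¬ q ∣ 1 + r * k).card := by
    rw [← Finset.card_filter_add_card_filter_not (s := (Finset.range B).filter fun k =>
      ¬ q ∣ 1 + r * k) (fun k => 1 + r * k ∈ U), Finset.filter_filter, Finset.filter_filter]
  omega

/-- Here `B - ⌊B / q⌋ = ⌈(q - 1) B / q⌉`, and `M` is an integer. -/
theorem le_add_div {q B M : ℕ} (hq : 0 < q) (h : (q - 1) * B ≤ q * M) : B ≤ M + B / q := by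
  obtain ⟨p, rfl⟩ : ∃ p, q = p + 1 := ⟨q - 1, by omega⟩
  have h1 := Nat.div_add_mod B (p + 1)
  have h2 := Nat.mod_lt B hq
  simp only [Nat.add_sub_cancel] at h
  by_contra! hlt
  generalize B / (p + 1) = d at *
  generalize B % (p + 1) = ρ at *
  subst h1
  nlinarith

/-! ### The exponents coming from `S_m` -/

/-- The integer attached to a triple `(i, j, t)`. -/
def tripleValue (q : ℕ) (x : ℕ × ℕ × ℕ) : ℕ := q ^ x.1 + q * x.2.2 + x.2.1

/-- This is the bound on `t` with its denominator cleared; it says that the conjugate `1 + w q ^ (m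
- i)` is smaller than `q ^ i + w`. -/
theorem lt_of_mem_setS {q n r m : ℕ} (hq : 1 < q) {x : ℕ × ℕ × ℕ} (hx : x ∈ setS q n r m) :
    x.1 < m ∧ (q * x.2.2 + x.2.1) * q ^ (m - x.1) + 1 < q ^ x.1 + (q * x.2.2 + x.2.1) := by
  obtain ⟨i, j, t, rfl, -, -, -, -, ht, -, -⟩ := hx
  have hq1 : (1 : ℝ) < q := by exact_mod_cast hq
  -- For `i ≥ m` the truncated exponent makes the denominator `q - q = 0`; division by zero gives
  -- `0`, so the bound would read `t < 0`.
  have him : i < m := by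
    by_contra! h
    rw [Nat.sub_eq_zero_of_le h] at ht
    simp only [zero_add, pow_one, sub_self, div_zero] at ht
    exact absurd ht (not_lt.mpr (Nat.cast_nonneg t))
  refine ⟨him, ?_⟩
  have hQ : (1 : ℝ) < (q : ℝ) ^ (m - i) := one_lt_pow₀ hq1 (by omega)
  rw [lt_div_iff₀ (by rw [pow_succ]; nlinarith), pow_succ] at ht
  have : (((q * t + j) * q ^ (m - i) + 1 : ℕ) : ℝ) < ((q ^ i + (q * t + j) : ℕ) : ℝ) := by
    push_cast
    linarith
  exact_mod_cast this

/-- The preceding inequality forces `w < q ^ i`, so `q ^ i + w` lies below `q ^ (i + 1)` and its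
base `q` logarithm recovers `i`. Then `j` is the remainder of `w` modulo `q`. -/
theorem tripleValue_injOn {q n r m : ℕ} (hq : 1 < q) :
    Set.InjOn (tripleValue q) (setS q n r m) := by
  have key : ∀ x ∈ setS q n r m, x.2.1 < q ∧ Nat.log q (tripleValue q x) = x.1 := by
    intro x hx
    obtain ⟨him, hlt⟩ := lt_of_mem_setS hq hx
    obtain ⟨i, j, t, rfl, -, -, -, hj, -, -, -⟩ := hx
    refine ⟨by simp only; omega, ?_⟩
    simp only [tripleValue] at *
    have hQ : 2 ≤ q ^ (m - i) := hq.trans_le (Nat.le_self_pow (by omega) q)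
    apply Nat.log_eq_of_pow_le_of_lt_pow
    · omega
    · have h1 := Nat.mul_le_mul_left (q * t + j) hQ
      have h2 : q ^ i * 2 ≤ q ^ i * q := Nat.mul_le_mul_left (q ^ i) hq
      rw [pow_succ]
      omega
  intro x hx y hy hxy
  obtain ⟨hx1, hx2⟩ := key x hx
  obtain ⟨hy1, hy2⟩ := key y hy
  have h1 : x.1 = y.1 := by rw [← hx2, ← hy2, hxy]
  simp only [tripleValue, h1] at hxy
  have h2 : q * x.2.2 + x.2.1 = q * y.2.2 + y.2.1 := by omega
  have h3 : x.2.1 = y.2.1 := by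
    have := congrArg (· % q) h2
    simpa [Nat.mul_add_mod, Nat.mod_eq_of_lt hx1, Nat.mod_eq_of_lt hy1] using this
  rw [h3] at h2
  have h4 : x.2.2 = y.2.2 := Nat.eq_of_mul_eq_mul_left (by omega) (Nat.add_right_cancel h2)
  exact Prod.ext h1 (Prod.ext h3 h4)

theorem tripleValue_spec {q n r m : ℕ} (hq : 1 < q) {x : ℕ × ℕ × ℕ} (hx : x ∈ setS q n r m) :
    ¬ q ∣ tripleValue q x ∧ 0 < tripleValue q x ∧ tripleValue q x ≡ 1 [MOD r] ∧
      (tripleValue q x : ℤ) ≤ 1 + (mainBound q n m - 2) * (r : ℤ) := by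
  obtain ⟨-, hlt⟩ := lt_of_mem_setS hq hx
  obtain ⟨i, j, t, rfl, -, -, hj1, hj, -, hmod, hle⟩ := hx
  refine ⟨fun hdvd => ?_, ?_, hmod, hle⟩
  · simp only [tripleValue] at *
    have hi : i ≠ 0 := by
      rintro rfl
      have := Nat.le_mul_of_pos_right (q * t + j) (pow_pos (by omega : 0 < q) (m - 0))
      rw [pow_zero] at hlt
      omega
    have : q ∣ j := (Nat.dvd_add_right ((dvd_pow_self q hi).add (dvd_mul_right q t))).mp hdvd
    have := Nat.le_of_dvd hj1 this
    omega
  · simp only [tripleValue]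
    omega

theorem setS_finite {q n r m : ℕ} (hq : 1 < q) : (setS q n r m).Finite := by
  refine Set.Finite.of_finite_image ?_ (tripleValue_injOn hq)
  refine (Set.finite_Iic (1 + (mainBound q n m - 2) * (r : ℤ)).toNat).subset ?_
  rintro _ ⟨x, hx, rfl⟩
  have := (tripleValue_spec hq hx).2.2.2
  simp only [Set.mem_Iic]
  omega

/-- Apply Frobenius `m - i` times: `q ^ i` becomes `q ^ m`, which acts on `β` as the exponent `1`.
-/
theorem exists_smaller_conjugate {F K : Type*} [Field F] [Fintype F] [Field K] [Algebra F K]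
    {n r m : ℕ} (hr : r ∣ Fintype.card F - 1) {β : K} (hβ : β ^ Fintype.card F ^ m = β)
    {x : ℕ × ℕ × ℕ} (hx : x ∈ setS (Fintype.card F) n r m) :
    ∃ k, 1 + r * k < tripleValue (Fintype.card F) x ∧
      minpoly F (β ^ tripleValue (Fintype.card F) x) = minpoly F (β ^ (1 + r * k)) := by
  have hq := Fintype.one_lt_card (α := F)
  set q := Fintype.card F with hqdef
  obtain ⟨him, hlt⟩ := lt_of_mem_setS hq hx
  obtain ⟨-, -, hmod, -⟩ := tripleValue_spec hq hx
  have hq1 := modEq_one_of_dvd_sub_one (by omega) hr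
  have hpow : ∀ j, q ^ j ≡ 1 [MOD r] := fun j => by simpa using hq1.pow j
  set w := q * x.2.2 + x.2.1 with hw
  have hval : tripleValue q x = q ^ x.1 + w := by rw [tripleValue, hw, add_assoc]
  have hmod' : 1 + w * q ^ (m - x.1) ≡ 1 [MOD r] := by
    rw [hval] at hmod
    have h1 : q ^ x.1 + w ≡ 1 + w * 1 [MOD r] := by
      rw [mul_one]
      exact (hpow x.1).add_right w
    exact (((hpow (m - x.1)).mul_left w).add_left 1).trans (h1.symm.trans hmod)
  obtain ⟨k, hk⟩ := exists_one_add_mul (by omega) hmod'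
  refine ⟨k, by omega, ?_⟩
  rw [← minpoly_pow_card_pow (β ^ tripleValue q x) (m - x.1), ← pow_mul, ← hqdef, hval, add_mul,
    ← pow_add, Nat.add_sub_cancel' him.le, pow_add, hβ, ← hk, pow_add, pow_one]

/-! ### Codes from representatives of conjugacy classes -/

theorem MinDistGE.mono {F : Type*} [Field F] [DecidableEq F] {n : ℕ} {C : Submodule F (Fin n → F)}
    {D D' : ℤ} (h : MinDistGE C D) (hD : D' ≤ D) : MinDistGE C D' :=
  fun x hx y hy hxy => hD.trans (h x hx y hy hxy)

theorem pow_ordMod_modEq (n q : ℕ) : q ^ ordMod n q ≡ 1 [MOD n] := by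
  rw [← ZMod.natCast_eq_natCast_iff]
  push_cast
  exact pow_orderOf_eq_one _

theorem ordMod_pos {n q : ℕ} (hn : n.Prime) (hnq : n.Coprime q) : 0 < ordMod n q := by
  have : NeZero n := ⟨hn.ne_zero⟩
  rw [ordMod, ← ZMod.coe_unitOfCoprime q hnq.symm, orderOf_units]
  exact orderOf_pos _

/-- Both `r` and `n` divide `q ^ m - 1`, and they are coprime because `r ∣ q - 1`. -/
theorem pow_card_pow_ordMod {F K : Type*} [Field F] [Fintype F] [Field K] {n r : ℕ}
    (hn : n.Prime) (hnq' : ¬ n ∣ Fintype.card F - 1) (hr : r ∣ Fintype.card F - 1) {β : K}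
    (hβ : β ^ (r * n) = 1) : β ^ Fintype.card F ^ ordMod n (Fintype.card F) = β := by
  have hq := Fintype.one_lt_card (α := F)
  have hcop : r.Coprime n :=
    (((hn.coprime_iff_not_dvd).mpr hnq').coprime_dvd_right hr).symm
  have hpos := pow_pos (zero_lt_one.trans hq) (ordMod n (Fintype.card F))
  have h1 : r * n ∣ Fintype.card F ^ ordMod n (Fintype.card F) - 1 := by
    refine hcop.mul_dvd_of_dvd_of_dvd ?_ ?_
    · exact hr.trans (Nat.sub_one_dvd_pow_sub_one _ _)
    · exact (Nat.modEq_iff_dvd' hpos).mp (pow_ordMod_modEq n _).symm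
  obtain ⟨d, hd⟩ := h1
  rw [show Fintype.card F ^ ordMod n (Fintype.card F) = r * n * d + 1 by omega, pow_succ, pow_mul,
    hβ, one_pow, one_mul]

/-- Counting form of the construction: given few representatives of the conjugacy classes of `B`
consecutive powers of `β`, there is a code whose set of zeros consists of `N` classes of size
`ordMod n q`, together with the rational zero if `T = {X - e}`. -/
theorem exists_code_of_representatives {F K : Type*} [Field F] [Fintype F] [DecidableEq F]
    [Field K] [Algebra F K] {n r B N : ℕ} (hn : n.Prime) (hnq : n.Coprime (Fintype.card F))
    {a e : F} (ha : a ≠ 0) (he : e ^ n = a) {β : K} (hβ : β ^ n = algebraMap F K a)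
    (hr : IsPrimitiveRoot (β ^ r) n) (L : Finset ℕ) (hL : L.card ≤ N)
    (hN : N * ordMod n (Fintype.card F) + 1 ≤ n) (T : Finset F[X]) (hT : T ⊆ {X - C e})
    (hTL : ∀ k ∈ L, minpoly F (β ^ (1 + r * k)) = X - C e → X - C e ∈ T)
    (hB : ∀ k < B, ∃ k' ∈ L, minpoly F (β ^ (1 + r * k)) = minpoly F (β ^ (1 + r * k'))) :
    ∃ C : Submodule F (Fin n → F), IsConstacyclic a C ∧
      Module.finrank F C + (T.card + N * ordMod n (Fintype.card F)) = n ∧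
      MinDistGE C (B + 1) := by
  classical
  have hβ0 : β ≠ 0 := by
    rintro rfl
    rw [zero_pow hn.ne_zero] at hβ
    exact ha (by simpa using hβ.symm)
  obtain ⟨P, hP, hPdeg, hPcard⟩ := exists_factors hn hnq ha he
  have hm := ordMod_pos hn hnq
  have hNP : N ≤ P.card := by
    refine Nat.le_of_mul_le_mul_right ?_ hm
    omega
  have hpow : ∀ k, (β ^ (1 + r * k)) ^ n = algebraMap F K a := by
    intro k
    rw [pow_add, pow_one, mul_pow, hβ, pow_mul, ← pow_mul, mul_comm k, pow_mul, hr.pow_eq_one,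
      one_pow, mul_one]
  have hmin : ∀ k, minpoly F (β ^ (1 + r * k)) ≠ X - C e → minpoly F (β ^ (1 + r * k)) ∈ P := by
    intro k hk
    have hint : IsIntegral F (β ^ (1 + r * k)) := by
      refine IsIntegral.of_pow hn.pos ?_
      rw [hpow]
      exact isIntegral_algebraMap
    refine (hP _).mpr ⟨hk, minpoly.irreducible hint, minpoly.monic hint, minpoly.dvd F _ ?_⟩
    simp [hpow]
  -- Pad the needed factors of degree `m` with arbitrary others up to exactly `N`, so that the
  -- dimension is exact; extra zeros keep the distance bound.
  obtain ⟨Q, hLQ, hQP, hQcard⟩ := Finset.exists_subsuperset_card_eq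
    (s := (L.image fun k => minpoly F (β ^ (1 + r * k))).erase (X - C e)) (t := P) (n := N)
    (by
      intro f hf
      obtain ⟨hfe, hf⟩ := Finset.mem_erase.mp hf
      obtain ⟨k, -, rfl⟩ := Finset.mem_image.mp hf
      exact hmin k hfe)
    ((Finset.card_le_card (Finset.erase_subset _ _)).trans (Finset.card_image_le.trans hL)) hNP
  have hTe : ∀ f ∈ T, f = X - C e := fun f hf => Finset.mem_singleton.mp (hT hf)
  have hdisj : Disjoint T Q := by
    rw [Finset.disjoint_left]
    intro f hf hfQ
    exact ((hP f).mp (hQP hfQ)).1 (hTe f hf)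
  obtain ⟨D, hD, hDdim, hDdist⟩ := exists_code_of_factors (B := B) hn.pos (a := a) hβ0 hr (T ∪ Q)
    (by
      intro f hf
      rcases Finset.mem_union.mp hf with hf | hf
      · exact hTe f hf ▸ irreducible_X_sub_C e
      · exact ((hP f).mp (hQP hf)).2.1)
    (by
      intro f hf
      rcases Finset.mem_union.mp hf with hf | hf
      · exact hTe f hf ▸ monic_X_sub_C e
      · exact ((hP f).mp (hQP hf)).2.2.1)
    (by
      intro f hf
      rcases Finset.mem_union.mp hf with hf | hf
      · rw [hTe f hf, dvd_iff_isRoot]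
        simp [he]
      · exact ((hP f).mp (hQP hf)).2.2.2)
    (by
      intro k hk
      obtain ⟨k', hk', heq⟩ := hB k hk
      rw [heq, Finset.mem_union]
      by_cases h : minpoly F (β ^ (1 + r * k')) = X - C e
      · exact Or.inl (h ▸ hTL k' hk' h)
      · exact Or.inr (hLQ (Finset.mem_erase.mpr ⟨h, Finset.mem_image_of_mem _ hk'⟩)))
  refine ⟨D, hD, ?_, hDdist⟩
  rw [Finset.sum_union hdisj, Finset.sum_congr rfl fun f hf => hPdeg f (hQP hf), Finset.sum_const,
    hQcard, Finset.sum_congr rfl fun f hf => (congrArg natDegree (hTe f hf)).trans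
    (natDegree_X_sub_C e), Finset.sum_const, smul_eq_mul, smul_eq_mul, mul_one] at hDdim
  exact hDdim

/-! ### The two families of codes -/

theorem halfCeil_eq {n m k : ℕ} (hm : 0 < m) (h : k * m + 1 = n) :
    halfCeil n m = ((k + 1) / 2 : ℕ) := by
  have hm' : (m : ℝ) ≠ 0 := by positivity
  have h1 : ((n : ℝ) - 1) / (2 * m) = (k : ℝ) / 2 := by
    rw [← h]
    push_cast
    field_simp
    ring
  rw [halfCeil, h1, Int.ceil_eq_iff]
  obtain ⟨c, rfl | rfl⟩ := Nat.even_or_odd' k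
  · rw [show (2 * c + 1) / 2 = c by omega]
    push_cast
    constructor <;> linarith
  · rw [show (2 * c + 1 + 1) / 2 = c + 1 by omega]
    push_cast
    constructor <;> linarith

theorem halfFloor_eq {n m k : ℕ} (hm : 0 < m) (h : k * m + 1 = n) :
    halfFloor n m = (k / 2 : ℕ) := by
  have hm' : (m : ℝ) ≠ 0 := by positivity
  have h1 : ((n : ℝ) - 1) / (2 * m) = (k : ℝ) / 2 := by
    rw [← h]
    push_cast
    field_simp
    ring
  rw [halfFloor, h1, Int.floor_eq_iff]
  obtain ⟨c, rfl | rfl⟩ := Nat.even_or_odd' k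
  · rw [show 2 * c / 2 = c by omega]
    push_cast
    constructor <;> linarith
  · rw [show (2 * c + 1) / 2 = c by omega]
    push_cast
    constructor <;> linarith

theorem ceil_sub_one_mul_lt {q N : ℕ} (hq : 1 < q) :
    (⌈(q : ℝ) * (N : ℝ) / ((q : ℝ) - 1)⌉ - 1) * ((q : ℤ) - 1) < q * N := by
  have hq' : (0 : ℝ) < (q : ℝ) - 1 := by
    have : (1 : ℝ) < q := by exact_mod_cast hq
    linarith
  have h := Int.ceil_lt_add_one ((q : ℝ) * (N : ℝ) / ((q : ℝ) - 1))
  rw [← sub_lt_iff_lt_add, lt_div_iff₀ hq'] at h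
  exact_mod_cast h

theorem exists_ceil_code {F : Type*} [Field F] [Fintype F] [DecidableEq F] (lam : Fˣ) {n : ℕ}
    (hn : n.Prime) (hnq : n.Coprime (Fintype.card F)) (hnq' : ¬ n ∣ Fintype.card F - 1) :
    ExistsConstacyclicCode (lam : F) n
      ((n : ℤ) - 1 - (ordMod n (Fintype.card F) : ℤ) * halfCeil n (ordMod n (Fintype.card F)))
      (mainBound (Fintype.card F) n (ordMod n (Fintype.card F)) +
        bigLambda (Fintype.card F) n (orderOf lam) (ordMod n (Fintype.card F))) := by
  classical
  have hq := Fintype.one_lt_card (α := F)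
  have hm := ordMod_pos hn hnq
  have hrq : orderOf lam ∣ Fintype.card F - 1 := by
    have := orderOf_dvd_card (x := lam)
    rwa [Fintype.card_units] at this
  have hr0 : 0 < orderOf lam := orderOf_pos lam
  obtain ⟨e, β, he, hβ, hprim⟩ := exists_primitive_pow (AlgebraicClosure F) hn hnq hnq' lam
  obtain ⟨P, -, -, hk⟩ := exists_factors hn hnq lam.ne_zero he
  generalize P.card = k at hk
  have hβm : β ^ Fintype.card F ^ ordMod n (Fintype.card F) = β :=
    pow_card_pow_ordMod hn hnq' hrq (by rw [pow_mul, hprim.pow_eq_one])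
  set q := Fintype.card F with hqdef
  set r := orderOf lam with hrdef
  set m := ordMod n q with hmdef
  have hk1 : 1 ≤ k := by
    by_contra! h0
    have := hn.two_le
    simp [Nat.lt_one_iff.mp h0] at hk
    omega
  set N := (k + 1) / 2 with hN
  have hceil : halfCeil n m = N := halfCeil_eq hm hk
  set U : Finset ℕ := (setS_finite (n := n) (r := r) (m := m) hq).toFinset.image (tripleValue q)
    with hU
  have hUmem : ∀ u ∈ U, ∃ x ∈ setS q n r m, tripleValue q x = u := by
    intro u hu
    obtain ⟨x, hx, rfl⟩ := Finset.mem_image.mp hu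
    exact ⟨x, (setS_finite hq).mem_toFinset.mp hx, rfl⟩
  have hUcard : U.card = (setS q n r m).ncard := by
    rw [hU, Finset.card_image_of_injOn, Set.ncard_eq_toFinset_card _ (setS_finite hq)]
    rw [Set.Finite.coe_toFinset]
    exact tripleValue_injOn hq
  have hA : (mainBound q n m - 1) * ((q : ℤ) - 1) < q * N := by
    rw [mainBound, hceil]
    exact_mod_cast ceil_sub_one_mul_lt (N := N) hq
  have hΛ : bigLambda q n r m * ((q : ℤ) - 1) < q * U.card := by
    rw [bigLambda, hUcard]
    exact ceil_sub_one_mul_lt hq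
  -- When `S_m` is empty, `Λ_m` equals `-1`; nonnegativity is needed only to place elements of `U`
  -- among the first `B` exponents.
  have hΛ0 : 0 < U.card → 0 ≤ bigLambda q n r m := by
    intro h0
    rw [hUcard] at h0
    have hq' : (0 : ℝ) < (q : ℝ) - 1 := by
      have : (1 : ℝ) < q := by exact_mod_cast hq
      linarith
    have hq0 : (0 : ℝ) < q := by linarith
    have h0' : (0 : ℝ) < (setS q n r m).ncard := by exact_mod_cast h0
    have : 0 < ⌈(q : ℝ) * ((setS q n r m).ncard : ℝ) / ((q : ℝ) - 1)⌉ :=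
      Int.ceil_pos.mpr (by positivity)
    rw [bigLambda]
    omega
  set B := (mainBound q n m + bigLambda q n r m - 1).toNat with hB
  have hBle : (q - 1) * B ≤ q * (N + U.card) := by
    rcases le_or_gt (mainBound q n m + bigLambda q n r m - 1) 0 with h | h
    · rw [hB, Int.toNat_of_nonpos h, mul_zero]
      exact Nat.zero_le _
    · zify [hq.le]
      rw [hB, Int.toNat_of_nonneg h.le]
      linarith
  have hUB : ∀ u ∈ U, ¬ q ∣ u ∧ ∃ k < B, u = 1 + r * k := by
    intro u hu
    have hΛ1 := hΛ0 (Finset.card_pos.mpr ⟨u, hu⟩)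
    obtain ⟨x, hx, rfl⟩ := hUmem u hu
    obtain ⟨h1, h2, h3, h4⟩ := tripleValue_spec hq hx
    obtain ⟨l, hl⟩ := exists_one_add_mul h2 h3
    refine ⟨h1, l, ?_, hl⟩
    rw [hl] at h4
    push_cast at h4
    -- The size condition in `S_m` bounds the index by `A - 2`, which is less than `B = A + Λ_m - 1`
    -- once `Λ_m ≥ 0`.
    have h5 : (l : ℤ) ≤ mainBound q n m - 2 := by
      refine le_of_mul_le_mul_left ?_ (by exact_mod_cast hr0 : (0 : ℤ) < r)
      linarith
    omega
  have hcard := card_filter_add_le hq hrq hUB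
  have hBdiv := le_add_div (zero_lt_one.trans hq) hBle
  have hNm : N * m + 1 ≤ n := by
    rw [← hk]
    exact Nat.add_le_add_right (Nat.mul_le_mul_right m (by omega)) 1
  -- Including `X - e` unconditionally costs one dimension but allows the first `B` exponents to
  -- meet the rational root.
  obtain ⟨D, hD, hdim, hdist⟩ := exists_code_of_representatives (B := B) (N := N) hn hnq lam.ne_zero
    he hβ hprim ((Finset.range B).filter fun k => ¬ q ∣ 1 + r * k ∧ 1 + r * k ∉ U) (by omega)
    hNm {X - C e} subset_rfl (fun _ _ _ => Finset.mem_singleton_self _) (by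
      intro l hl
      obtain ⟨l', hl', h1, h2, h3⟩ := exists_conjugate (β := β) (U := U) hrq (by
        intro u hu
        obtain ⟨x, hx, rfl⟩ := hUmem u hu
        exact exists_smaller_conjugate hrq hβm hx) l
      exact ⟨l', Finset.mem_filter.mpr
        ⟨Finset.mem_range.mpr (hl'.trans_lt hl), h1, h2⟩, h3⟩)
  refine ⟨D, hD, ?_, hdist.mono (by omega)⟩
  rw [hceil]
  rw [Finset.card_singleton] at hdim
  have hdim' : (Module.finrank F D : ℤ) + (1 + N * m) = n := by exact_mod_cast hdim
  linarith

theorem exists_floor_code {F : Type*} [Field F] [Fintype F] [DecidableEq F] (lam : Fˣ) {n : ℕ}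
    (hn : n.Prime) (hnq : n.Coprime (Fintype.card F)) (hnq' : ¬ n ∣ Fintype.card F - 1)
    (hqr : Fintype.card F * orderOf lam ≤
      2 * ordMod n (Fintype.card F) * (Fintype.card F - 1)) :
    ExistsConstacyclicCode (lam : F) n
      ((n : ℤ) - (ordMod n (Fintype.card F) : ℤ) * halfFloor n (ordMod n (Fintype.card F)))
      ⌊(Fintype.card F : ℝ) * ((n : ℝ) - 1) /
        (2 * (ordMod n (Fintype.card F) : ℝ) * ((Fintype.card F : ℝ) - 1))⌋ := by
  classical
  have hq := Fintype.one_lt_card (α := F)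
  have hm := ordMod_pos hn hnq
  have hrq : orderOf lam ∣ Fintype.card F - 1 := by
    have := orderOf_dvd_card (x := lam)
    rwa [Fintype.card_units] at this
  have hr0 : 0 < orderOf lam := orderOf_pos lam
  obtain ⟨e, β, he, hβ, hprim⟩ := exists_primitive_pow (AlgebraicClosure F) hn hnq hnq' lam
  have hβ0 : β ≠ 0 := by
    rintro rfl
    rw [zero_pow hn.ne_zero] at hβ
    exact lam.ne_zero (by simpa using hβ.symm)
  obtain ⟨P, -, -, hk⟩ := exists_factors hn hnq lam.ne_zero he
  generalize P.card = k at hk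
  set q := Fintype.card F with hqdef
  set r := orderOf lam with hrdef
  set m := ordMod n q with hmdef
  set N := k / 2 with hN
  have hfloor : halfFloor n m = N := halfFloor_eq hm hk
  set d := ⌊(q : ℝ) * ((n : ℝ) - 1) / (2 * (m : ℝ) * ((q : ℝ) - 1))⌋ with hd
  have hdle : d * (2 * ((q : ℤ) - 1)) ≤ q * k := by
    have hq' : (0 : ℝ) < (q : ℝ) - 1 := by
      have : (1 : ℝ) < q := by exact_mod_cast hq
      linarith
    have hm' : (0 : ℝ) < m := by exact_mod_cast hm
    have h := Int.floor_le ((q : ℝ) * ((n : ℝ) - 1) / (2 * (m : ℝ) * ((q : ℝ) - 1)))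
    rw [← hd, show (q : ℝ) * ((n : ℝ) - 1) / (2 * (m : ℝ) * ((q : ℝ) - 1)) =
      q * k / (2 * ((q : ℝ) - 1)) by
        rw [← hk]
        push_cast
        field_simp
        ring, le_div_iff₀ (by positivity)] at h
    exact_mod_cast h
  set B := (d - 1).toNat with hB
  have hBle : (q - 1) * B ≤ q * N := by
    rcases le_or_gt (d - 1) 0 with h | h
    · rw [hB, Int.toNat_of_nonpos h, mul_zero]
      exact Nat.zero_le _
    -- Passing from `d` to `d - 1` gains `2 (q - 1)`, at least the loss `q` from rounding `k / 2`
    -- down when `k` is odd.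
    · have hkN : (k : ℤ) ≤ 2 * N + 1 := by omega
      have hq2 : (2 : ℤ) ≤ q := by exact_mod_cast hq
      zify [hq.le]
      rw [hB, Int.toNat_of_nonneg h.le]
      nlinarith
  -- The hypothesis `q r ≤ 2 m (q - 1)` turns `2 (q - 1) d ≤ q k` into `r d ≤ k m = n - 1`.
  have hlt : ∀ l < B, 1 + r * l < n := by
    intro l hl
    have h1 : (l : ℤ) + 2 ≤ d := by omega
    have hqr' : (q : ℤ) * r ≤ 2 * m * (q - 1) := by
      zify [hq.le] at hqr
      exact hqr
    have hq2 : (0 : ℤ) < q - 1 := by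
      have : (1 : ℤ) < q := by exact_mod_cast hq
      omega
    have h2 : ((r : ℤ) * (l + 2)) * (2 * (q - 1)) ≤ (k * m) * (2 * (q - 1)) :=
      calc ((r : ℤ) * (l + 2)) * (2 * (q - 1)) ≤ (r * d) * (2 * (q - 1)) := by gcongr
        _ = r * (d * (2 * (q - 1))) := by ring
        _ ≤ r * (q * k) := by gcongr
        _ = (q * r) * k := by ring
        _ ≤ (2 * m * (q - 1)) * k := by gcongr
        _ = _ := by ring
    have h3 : (r : ℤ) * (l + 2) ≤ k * m := le_of_mul_le_mul_right h2 (by positivity)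
    have h4 : r * (l + 2) ≤ k * m := by exact_mod_cast h3
    rw [← hk]
    rw [mul_add] at h4
    omega
  have hcard := card_filter_add_le (B := B) (U := ∅) hq hrq (by simp)
  have hBdiv := le_add_div (zero_lt_one.trans hq) hBle
  rw [Finset.card_empty] at hcard
  have hNm : N * m + 1 ≤ n := by
    rw [← hk]
    exact Nat.add_le_add_right (Nat.mul_le_mul_right m (by omega)) 1
  -- No exponent reaches `n`, so none gives the rational root and the factor `X - e` can be left
  -- out.
  obtain ⟨D, hD, hdim, hdist⟩ := exists_code_of_representatives (B := B) (N := N) hn hnq lam.ne_zero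
    he hβ hprim ((Finset.range B).filter fun k => ¬ q ∣ 1 + r * k ∧ 1 + r * k ∉ (∅ : Finset ℕ))
    (by omega) hNm ∅ (Finset.empty_subset _) (by
      intro l hl hmin
      have hlB := Finset.mem_range.mp (Finset.mem_filter.mp hl).1
      have hroot := minpoly.aeval F (β ^ (1 + r * l))
      rw [hmin, map_sub, aeval_X, aeval_C, sub_eq_zero] at hroot
      have hdvd := dvd_of_pow_eq_algebraMap hn hnq' hβ0 hprim hroot
      exact absurd (Nat.le_of_dvd (by omega) hdvd) (not_le.mpr (hlt l hlB))) (by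
      intro l hl
      obtain ⟨l', hl', h1, h2, h3⟩ := exists_conjugate (β := β) (U := ∅) hrq (by simp) l
      exact ⟨l', Finset.mem_filter.mpr
        ⟨Finset.mem_range.mpr (hl'.trans_lt hl), h1, h2⟩, h3⟩)
  refine ⟨D, hD, ?_, hdist.mono (by omega)⟩
  rw [hfloor]
  rw [Finset.card_empty] at hdim
  have hdim' : (Module.finrank F D : ℤ) + (0 + N * m) = n := by exact_mod_cast hdim
  linarith

/-! ### Infinitely many admissible lengths -/

theorem lt_ordMod {n q M : ℕ} (hq : 1 < q) (hn : n.Prime) (hnq : n.Coprime q) (hM : q ^ M < n) :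
    M < ordMod n q := by
  by_contra! h
  have h1 : q ^ ordMod n q ≤ q ^ M := Nat.pow_le_pow_right (by omega) h
  have h2 : 1 < q ^ ordMod n q := Nat.one_lt_pow (ordMod_pos hn hnq).ne' hq
  have h3 := (Nat.modEq_iff_dvd' h2.le).mp (pow_ordMod_modEq n q).symm
  have := Nat.le_of_dvd (by omega) h3
  omega

theorem infinite_setOf_primes {q r : ℕ} (hq : 1 < q) :
    {n : ℕ | n.Prime ∧ n.Coprime q ∧ ¬ n ∣ q - 1 ∧
      q * r ≤ 2 * ordMod n q * (q - 1)}.Infinite := by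
  refine Set.infinite_of_forall_exists_gt fun b => ?_
  -- A prime above `q ^ r` has `m > r`, which suffices because `q ≤ 2 (q - 1)`; exceeding `q` rules
  -- out dividing `q` or `q - 1`.
  obtain ⟨n, hbn, hn⟩ := Nat.exists_infinite_primes (b + q + q ^ r + 1)
  have hnq : n.Coprime q :=
    (hn.coprime_iff_not_dvd).mpr fun h => by
      have := Nat.le_of_dvd (by omega) h
      omega
  refine ⟨n, ⟨hn, hnq, fun h => ?_, ?_⟩, by omega⟩
  · have := Nat.le_of_dvd (by omega) h
    omega
  · have h1 : r ≤ ordMod n q := (lt_ordMod hq hn hnq (by omega)).le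
    calc q * r ≤ (2 * (q - 1)) * ordMod n q := Nat.mul_le_mul (by omega) h1
      _ = 2 * ordMod n q * (q - 1) := by ring

theorem theorem3 {F : Type*} [Field F] [Fintype F] [DecidableEq F] (q r : ℕ)
    (hq : Fintype.card F = q) (lam : Fˣ) (hr : orderOf lam = r) :
    -- both families are infinite
    {n : ℕ | n.Prime ∧ n.Coprime q ∧ ¬ n ∣ q - 1}.Infinite ∧
    {n : ℕ | n.Prime ∧ n.Coprime q ∧ ¬ n ∣ q - 1 ∧ q * r ≤ 2 * ordMod n q * (q - 1)}.Infinite ∧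
    ∀ n : ℕ, n.Prime → n.Coprime q → ¬ n ∣ q - 1 → ∀ m : ℕ, m = ordMod n q →
      -- first family
      ExistsConstacyclicCode (lam : F) n ((n : ℤ) - 1 - (m : ℤ) * halfCeil n m)
        (mainBound q n m + bigLambda q n r m) ∧
      -- second family
      (q * r ≤ 2 * m * (q - 1) →
        ExistsConstacyclicCode (lam : F) n ((n : ℤ) - (m : ℤ) * halfFloor n m)
          ⌊(q : ℝ) * ((n : ℝ) - 1) / (2 * (m : ℝ) * ((q : ℝ) - 1))⌋) := by
  have hq1 : 1 < q := hq ▸ Fintype.one_lt_card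
  have hinf := infinite_setOf_primes (r := r) hq1
  refine ⟨hinf.mono fun n hn => ⟨hn.1, hn.2.1, hn.2.2.1⟩, hinf, ?_⟩
  rintro n hn hnq hnq' m rfl
  subst hq hr
  exact ⟨exists_ceil_code lam hn hnq hnq', exists_floor_code lam hn hnq hnq'⟩
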